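/- A \emph{$2$-edge-coloured graph} $\mathbb H$ is a finite set $H$ of vertices with two symmetric binary relations $R(\mathbb H)$ (red edges) and $B(\mathbb H)$ (blue edges); loops, and edges of both colours, are allowed. It is \emph{reflexive} if every vertex has a loop of at least one colour, and \emph{complete} if any two distinct vertices are joined by an edge of at least one colour. The \emph{homogeneous concatenation} $\mathbb H\triangleleft_h\mathbb A$ of two $2$-edge-coloured graphs is obtained from their disjoint union by adding, for all $h\in H$ and $a\in A$, a blue edge $ha$ if $aa\in B(\mathbb A)$, and a red edge $ha$ if $aa\in R(\mathbb A)$. A \emph{reflexive $\ast$-edge} is a reflexive $2$-edge-coloured graph with exactly two vertices, joined by both a red and a blue edge. In the \emph{list version of} $\mathrm{CSP}(\mathbb H)$, for a fixed $\mathbb H$, the input is a finite structure $\mathbb G$ with two binary relations $R(\mathbb G)$ and $B(\mathbb G)$ (in particular, it may be any $2$-edge-coloured graph) together with a list $L(u)\subseteq H$ for each vertex $u$ of $\mathbb G$, and the question is whether there is a map $f\colon G\to H$ that preserves both relations and satisfies $f(u)\in L(u)$ for every $u\in G$. **Theorem.** Let $\mathbb H$ be a finite reflexive complete $2$-edge-coloured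 graph that admits a decomposition (up to isomorphism) \[ \mathbb H=\mathbb A_1\triangleleft_h\mathbb A_2\triangleleft_h\dots\triangleleft_h\mathbb A_k ,\qquad k\ge 1, \] where $\mathbb A_1$ is a $2$-edge-coloured graph with exactly two vertices and, for each $2\le i\le k$, $\mathbb A_i$ is either a single vertex with a loop or a reflexive $\ast$-edge. Then the list version of $\mathrm{CSP}(\mathbb H)$ can be solved in polynomial time: there is a Turing machine that decides it in a number of steps bounded by a polynomial in the length of the input (given by the lists and the adjacency matrices of the two relations). -/

import Mathlib

namespace TwoEC

/-- A relational structure over the signature with two binary symbols `R` (red) and `B` (blue). -/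
structure RBStructure (V : Type) where
  R : V → V → Prop
  B : V → V → Prop

/-- A 2-edge-coloured graph: both relations are symmetric.  Loops, and edges carrying both
colours, are allowed. -/
structure Graph (V : Type) extends RBStructure V where
  symm_R : ∀ u v, R u v → R v u
  symm_B : ∀ u v, B u v → B v u

/-- Every vertex carries a loop (red, blue, or both). -/
def Graph.Reflexive {V : Type} (H : Graph V) : Prop :=
  ∀ v, H.R v v ∨ H.B v v

/-- Any two distinct vertices are joined by an edge (red, blue, or both). -/
def Graph.Complete {V : Type} (H : Graph V) : Prop :=
  ∀ u v, u ≠ v → H.R u v ∨ H.B u v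

/-- `f` is a homomorphism from `G` to `H`. -/
def IsHom {U V : Type} (G : RBStructure U) (H : RBStructure V) (f : U → V) : Prop :=
  (∀ u v, G.R u v → H.R (f u) (f v)) ∧ (∀ u v, G.B u v → H.B (f u) (f v))

/-- Isomorphism of 2-edge-coloured graphs. -/
def Isomorphic {U V : Type} (G : Graph U) (H : Graph V) : Prop :=
  ∃ e : U ≃ V, (∀ u v, G.R u v ↔ H.R (e u) (e v)) ∧ (∀ u v, G.B u v ↔ H.B (e u) (e v))

/-! ### Homogeneous concatenation -/

/-- One colour of the homogeneous concatenation: the disjoint union of the relations `S` and `T`,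
where moreover each vertex `a` of the second part is joined to all vertices of the first part
exactly if `a` has a loop of that colour. -/
def concatRel {V W : Type} (S : V → V → Prop) (T : W → W → Prop) : V ⊕ W → V ⊕ W → Prop
  | .inl h, .inl h' => S h h'
  | .inr a, .inr a' => T a a'
  | .inl _, .inr a => T a a
  | .inr a, .inl _ => T a a

theorem concatRel_symm {V W : Type} {S : V → V → Prop} {T : W → W → Prop}
    (hS : ∀ u v, S u v → S v u) (hT : ∀ u v, T u v → T v u) :
    ∀ x y, concatRel S T x y → concatRel S T y x
  | .inl h, .inl h' => hS h h'
  | .inr a, .inr a' => hT a a'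
  | .inl _, .inr _ => id
  | .inr _, .inl _ => id

/-- The homogeneous concatenation of `H` and `A`. -/
def Graph.concat {V W : Type} (H : Graph V) (A : Graph W) : Graph (V ⊕ W) where
  R := concatRel H.R A.R
  B := concatRel H.B A.B
  symm_R := concatRel_symm H.symm_R A.symm_R
  symm_B := concatRel_symm H.symm_B A.symm_B

/-- A 2-edge-coloured graph bundled with its vertex set. -/
abbrev AnyGraph : Type 1 := Σ V : Type, Graph V

/-- The homogeneous concatenation of bundled graphs. -/
def AnyGraph.concat (X Y : AnyGraph) : AnyGraph :=
  ⟨X.1 ⊕ Y.1, X.2.concat Y.2⟩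

/-- A single vertex with a loop. -/
def Graph.IsLoopedVertex {V : Type} (A : Graph V) : Prop :=
  Nat.card V = 1 ∧ A.Reflexive

/-- A reflexive `∗`-edge: two vertices, each with a loop, joined by both a red and a blue edge. -/
def Graph.IsReflexiveStarEdge {V : Type} (A : Graph V) : Prop :=
  Nat.card V = 2 ∧ A.Reflexive ∧ ∀ u v, u ≠ v → A.R u v ∧ A.B u v

/-- `H` is (isomorphic to) a homogeneous concatenation `A₁ ◁ A₂ ◁ ⋯ ◁ A_k` with `k ≥ 1`, where `A₁`
has exactly two vertices and each of the members `A₂, …, A_k` of the list `As` is a looped vertex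
or a reflexive `∗`-edge. -/
def Graph.HasDecomposition {V : Type} (H : Graph V) : Prop :=
  ∃ (A₁ : AnyGraph) (As : List AnyGraph),
    Nat.card A₁.1 = 2 ∧
    (∀ A ∈ As, A.2.IsLoopedVertex ∨ A.2.IsReflexiveStarEdge) ∧
    Isomorphic H (As.foldl AnyGraph.concat A₁).2

/-! ### The list version of the constraint satisfaction problem, and polynomial time -/

/-- An input of the list version of `CSP(H)`, `V` being the vertex set of `H`: a finite
structure `G` with two binary relations on the vertex set `{0, …, n - 1}`, and a list
`L u ⊆ V` for each vertex `u` of `G`. -/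
structure ListInstance (V : Type) where
  n : ℕ
  G : RBStructure (Fin n)
  L : Fin n → Set V

/-- The question: is there a homomorphism from `G` to `H` that respects the lists? -/
def ListInstance.IsYes {V : Type} (I : ListInstance V) (H : Graph V) : Prop :=
  ∃ f : Fin I.n → V, IsHom I.G H.toRBStructure f ∧ ∀ u, f u ∈ I.L u

/-- The input alphabet, which is finite for each finite `V`. -/
inductive InputSymbol (V : Type) where
  | vertex (L : Set V)
  | pair (red blue : Bool)

open scoped Classical in
/-- The input string: for each vertex `u` in turn, its list, followed by the row of `u` in the
adjacency matrices of the red and the blue relation.  It has length `n * (n + 1)`. -/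
noncomputable def ListInstance.encode {V : Type} (I : ListInstance V) : List (InputSymbol V) :=
  (List.finRange I.n).flatMap fun u =>
    InputSymbol.vertex (I.L u) ::
      (List.finRange I.n).map fun v =>
        InputSymbol.pair (decide (I.G.R u v)) (decide (I.G.B u v))

open scoped Classical in
/-- The list version of `CSP(H)` is solvable in polynomial time: some Turing machine, on each
input `I`, halts with the correct answer (one bit) within a number of steps that is bounded by a
polynomial in the length of the input string. -/
def Graph.ListCSPInPolyTime {V : Type} (H : Graph V) : Prop :=
  Nonempty (Turing.TM2ComputableInPolyTime (ListInstance.encode (V := V))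
    Computability.encodeBool (fun I : ListInstance V => decide (I.IsYes H)))

end TwoEC

/-! Let the level of a vertex of `H` be the index of its block in the decomposition, counted from
`0`. The problem is decided by path consistency. A matrix of binary relations `E u v` on `V`,
initialised by the lists and the edges of the input, is shrunk until every surviving pair extends to
every third vertex. No solution is ever lost, so an empty matrix means that there is none.

Conversely, a nonempty path consistent matrix yields a solution that uses only top values, the
surviving values of maximal level at each vertex. If two vertices have different top levels, all
their top values are compatible, because the loops of the higher value decide its edges to
everything below it (`compat_of_lvl_lt`). In general, fix a top value `a` at some vertex `u`. A
vertex is forced if `a` leaves exactly one value there and this value is top. Forced values are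
compatible with each other by path consistency, and with every top value at every unforced vertex by
`compat_of_forced`. The unforced vertices can therefore be treated independently, by induction
(`exists_assignment_on`).

For the running time, a machine performs pivot steps cyclically over the `n` vertices. A round that
changes nothing certifies path consistency, and any other round deletes one of the at most `n² |V|²`
surviving pairs (`runs_round`, `runs_loop`). A pivot step costs `O(n²)` machine steps
(`runs_pivot`), so the total is polynomial (`runs_machine`). -/

namespace TwoEC

open SetRel Turing StateTransition

/-! ### Level functions -/

/-- A level function on a 2-edge-coloured graph: the loops of a vertex determine its edges to the
vertices of lower level, and every level has at most two vertices, which are joined by edges of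
both colours except possibly in level `0`. -/
structure Graph.IsLevel {V : Type} (H : Graph V) (lvl : V → ℕ) : Prop where
  red_iff : ∀ x y, lvl x < lvl y → (H.R x y ↔ H.R y y)
  blue_iff : ∀ x y, lvl x < lvl y → (H.B x y ↔ H.B y y)
  star : ∀ x y, lvl x = lvl y → 0 < lvl y → x ≠ y → H.R x y ∧ H.B x y
  two : ∀ x y z, lvl x = lvl y → lvl y = lvl z → x = y ∨ y = z ∨ x = z

theorem eq_or_eq_or_eq_of_natCard_le_two {W : Type} [Finite W] (h : Nat.card W ≤ 2) (x y z : W) :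
    x = y ∨ y = z ∨ x = z := by
  classical
  have := Fintype.ofFinite W
  by_contra! hne
  have h3 : ({x, y, z} : Finset W).card = 3 := Finset.card_eq_three.2 ⟨x, y, z, hne.1, hne.2.2,
    hne.2.1, rfl⟩
  have := Finset.card_le_univ ({x, y, z} : Finset W)
  rw [Nat.card_eq_fintype_card] at h
  omega

theorem Graph.IsLevel.concat {V W : Type} {H : Graph V} {A : Graph W} {lvl : V → ℕ} {N : ℕ}
    (h : H.IsLevel lvl) (hN : ∀ x, lvl x ≤ N)
    (hA : A.IsLoopedVertex ∨ A.IsReflexiveStarEdge) :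
    (H.concat A).IsLevel (Sum.elim lvl fun _ => N + 1) := by
  have hcard : Nat.card W = 1 ∨ Nat.card W = 2 := hA.imp And.left And.left
  have : Finite W := Nat.finite_of_card_ne_zero (by omega)
  have htwo := eq_or_eq_or_eq_of_natCard_le_two (W := W) (by omega)
  have hstar : ∀ a b : W, a ≠ b → A.R a b ∧ A.B a b := by
    rcases hA with hA | hA
    · have := (Nat.card_eq_one_iff_unique.1 hA.1).1
      exact fun a b hab => absurd (Subsingleton.elim a b) hab
    · exact hA.2.2
  refine ⟨?_, ?_, ?_, ?_⟩
  · rintro (x | x) (y | y) hxy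
    · exact h.red_iff x y hxy
    · exact Iff.rfl
    · have := hN y; simp at hxy; omega
    · simp at hxy
  · rintro (x | x) (y | y) hxy
    · exact h.blue_iff x y hxy
    · exact Iff.rfl
    · have := hN y; simp at hxy; omega
    · simp at hxy
  · rintro (x | x) (y | y) hxy hy hne
    · exact h.star x y hxy hy fun e => hne (congrArg _ e)
    · have := hN x; simp at hxy; omega
    · have := hN y; simp at hxy; omega
    · exact hstar x y fun e => hne (congrArg _ e)
  · rintro (x | x) (y | y) (z | z) hxy hyz
    · simpa using h.two x y z hxy hyz
    · have := hN y; simp at hyz; omega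
    · have := hN x; simp at hxy; omega
    · have := hN x; simp at hxy; omega
    · have := hN y; simp at hxy; omega
    · have := hN y; simp at hxy; omega
    · have := hN z; simp at hyz; omega
    · simpa using htwo x y z

theorem exists_isLevel_foldl_concat (As : List AnyGraph) (A₁ : AnyGraph) (hA₁ : Nat.card A₁.1 = 2)
    (hAs : ∀ A ∈ As, A.2.IsLoopedVertex ∨ A.2.IsReflexiveStarEdge) :
    ∃ (lvl : (As.foldl AnyGraph.concat A₁).1 → ℕ) (N : ℕ), (∀ x, lvl x ≤ N) ∧
      (As.foldl AnyGraph.concat A₁).2.IsLevel lvl := by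
  induction As using List.reverseRecOn with
  | nil =>
    have : Finite A₁.1 := Nat.finite_of_card_ne_zero (by omega)
    -- At level `0` the star condition is void, so `A₁` may be arbitrary.
    exact ⟨fun _ => 0, 0, fun _ => le_rfl, fun _ _ h => absurd h (lt_irrefl _),
      fun _ _ h => absurd h (lt_irrefl _), fun _ _ _ h => absurd h (lt_irrefl _),
      fun x y z _ _ => eq_or_eq_or_eq_of_natCard_le_two hA₁.le x y z⟩
  | append_singleton As A ih =>
    obtain ⟨lvl, N, hN, h⟩ := ih fun A hA => hAs A (List.mem_append_left _ hA)
    rw [List.foldl_concat]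
    refine ⟨Sum.elim lvl fun _ => N + 1, N + 1, ?_, h.concat hN (hAs A (by simp))⟩
    rintro (x | x)
    · exact (hN x).trans (Nat.le_succ N)
    · exact le_rfl

theorem Graph.HasDecomposition.exists_isLevel {V : Type} {H : Graph V} (h : H.HasDecomposition) :
    ∃ lvl, H.IsLevel lvl := by
  obtain ⟨A₁, As, hA₁, hAs, e, hR, hB⟩ := h
  obtain ⟨lvl, N, -, hl⟩ := exists_isLevel_foldl_concat As A₁ hA₁ hAs
  refine ⟨lvl ∘ e, fun x y hxy => ?_, fun x y hxy => ?_, fun x y hxy hy hne => ?_,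
    fun x y z hxy hyz => ?_⟩
  · rw [hR, hR]; exact hl.red_iff _ _ hxy
  · rw [hB, hB]; exact hl.blue_iff _ _ hxy
  · rw [hR, hB]; exact hl.star _ _ hxy hy fun h => hne (e.injective h)
  · simpa using hl.two (e x) (e y) (e z) hxy hyz

/-! ### Path consistency -/

section Pivot

variable {α V : Type} [DecidableEq α]

/-- The pivot row `w` after the pivot step. -/
def pivotRow (E : α → α → SetRel V V) (w v : α) : SetRel V V :=
  if v = w then E w w ∩ SetRel.id else E w v ∩ ((E w w ∩ SetRel.id) ○ E w v)

/-- The pivot column `w` after the pivot step, outside the diagonal. -/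
def pivotCol (E : α → α → SetRel V V) (w u : α) : SetRel V V :=
  E u w ∩ (pivotRow E w u).inv

/-- The pivot step at `w` of the path consistency algorithm. -/
def pivot (E : α → α → SetRel V V) (w u v : α) : SetRel V V :=
  if u = w then pivotRow E w v
  else if v = w then pivotCol E w u
  else E u v ∩ (pivotCol E w u ○ pivotRow E w v)

theorem pivot_le (E : α → α → SetRel V V) (w : α) : pivot E w ≤ E := by
  intro u v
  unfold pivot
  split_ifs with hu hv
  · subst hu
    unfold pivotRow
    split_ifs with hv
    · subst hv; exact Set.inter_subset_left
    · exact Set.inter_subset_left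
  · subst hv; exact Set.inter_subset_left
  · exact Set.inter_subset_left

/-- The pairs of values of an assignment survive. -/
def Preserves (s : α → V) (E : α → α → SetRel V V) : Prop :=
  ∀ u v, (s u, s v) ∈ E u v

/-- Soundness: in every composition the value `s w` serves as the intermediate point. -/
theorem Preserves.pivot {s : α → V} {E : α → α → SetRel V V} (h : Preserves s E) (w : α) :
    Preserves s (pivot E w) := by
  have hrow : ∀ v, (s w, s v) ∈ pivotRow E w v := by
    intro v
    unfold pivotRow
    split_ifs with hv
    · subst hv; exact ⟨h _ _, rfl⟩
    · exact ⟨h _ _, s w, ⟨h _ _, rfl⟩, h _ _⟩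
  have hcol : ∀ u, (s u, s w) ∈ pivotCol E w u := fun u => ⟨h _ _, hrow u⟩
  intro u v
  unfold TwoEC.pivot
  split_ifs with hu hv
  · subst hu; exact hrow v
  · subst hv; exact hcol u
  · exact ⟨h _ _, s w, hcol u, hrow v⟩

/-- A matrix of relations is path consistent if no pivot step changes it. -/
def PathConsistent (E : α → α → SetRel V V) : Prop :=
  ∀ w, pivot E w = E

variable {E : α → α → SetRel V V} (hE : PathConsistent E)
include hE

theorem PathConsistent.eq_of_mem_diag {w : α} {a b : V} (h : (a, b) ∈ E w w) : a = b := by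
  rw [← hE w] at h
  simp only [pivot, pivotRow, if_true] at h
  exact h.2

theorem PathConsistent.mem_diag_left {u v : α} {a b : V} (h : (a, b) ∈ E u v) :
    (a, a) ∈ E u u := by
  by_cases huv : v = u
  · subst huv
    obtain rfl := hE.eq_of_mem_diag h
    exact h
  · rw [← hE u] at h
    simp only [pivot, pivotRow, if_true, if_neg huv] at h
    obtain ⟨-, c, ⟨h1, rfl : a = c⟩, -⟩ := h
    exact h1

/-- The pivot at `v` cuts column `v` down to the inverse of row `v`. -/
theorem PathConsistent.symm {u v : α} {a b : V} (h : (a, b) ∈ E u v) : (b, a) ∈ E v u := by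
  by_cases huv : u = v
  · subst huv
    obtain rfl := hE.eq_of_mem_diag h
    exact h
  · rw [← hE v] at h
    simp only [pivot, if_true, if_neg huv] at h
    have h2 : (b, a) ∈ pivotRow E v u := h.2
    rw [← hE v]
    simpa only [pivot, if_true] using h2

theorem PathConsistent.mem_diag_right {u v : α} {a b : V} (h : (a, b) ∈ E u v) :
    (b, b) ∈ E v v :=
  hE.mem_diag_left (hE.symm h)

/-- The composition in the pivot at `w` supplies `c`; if `w` is `u` or `v`, then `a` or `b` itself
serves. -/
theorem PathConsistent.exists_mem {u v : α} (w : α) {a b : V} (h : (a, b) ∈ E u v) :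
    ∃ c, (a, c) ∈ E u w ∧ (c, b) ∈ E w v := by
  by_cases hu : u = w
  · subst hu
    exact ⟨a, hE.mem_diag_left h, h⟩
  by_cases hv : v = w
  · subst hv
    exact ⟨b, h, hE.mem_diag_right h⟩
  rw [← hE w] at h
  simp only [pivot, if_neg hu, if_neg hv] at h
  obtain ⟨-, c, h1, h2⟩ := h
  refine ⟨c, ?_, ?_⟩
  · rw [← hE w]
    simpa only [pivot, if_true, if_neg hu] using h1
  · rw [← hE w]
    simpa only [pivot, if_true, if_neg hu] using h2

/-- This is why inspecting a single diagonal entry suffices for the answer. -/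
theorem PathConsistent.exists_mem_diag {z : α} (hz : (E z z).Nonempty) (w : α) :
    ∃ a, (a, a) ∈ E w w := by
  obtain ⟨⟨a, b⟩, h⟩ := hz
  obtain ⟨c, h1, -⟩ := hE.exists_mem w h
  exact ⟨c, hE.mem_diag_right h1⟩

end Pivot

/-- The initial relation of a pair of vertices, given the list of the first one and the colours of
the edges from the first one to the second one. -/
def initRel {V : Type} (H : Graph V) (L : Set V) (red blue : Bool) : SetRel V V :=
  {p | p.1 ∈ L ∧ (red = true → H.R p.1 p.2) ∧ (blue = true → H.B p.1 p.2)}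

open scoped Classical in
/-- The initial matrix of relations. -/
noncomputable def ListInstance.initMatrix {V : Type} (I : ListInstance V) (H : Graph V)
    (u v : Fin I.n) : SetRel V V :=
  initRel H (I.L u) (decide (I.G.R u v)) (decide (I.G.B u v))

/-- The values of maximal level that a path consistent matrix allows at a vertex. -/
def IsTop {α V : Type} (lvl : V → ℕ) (E : α → α → SetRel V V) (u : α) (a : V) : Prop :=
  (a, a) ∈ E u u ∧ ∀ b, (b, b) ∈ E u u → lvl b ≤ lvl a

/-- The edge constraints between two vertices are respected by the values `a` and `b`. -/
def Compat {α V : Type} (G : RBStructure α) (H : Graph V) (u v : α) (a b : V) : Prop :=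
  (G.R u v → H.R a b) ∧ (G.B u v → H.B a b) ∧ (G.R v u → H.R b a) ∧ (G.B v u → H.B b a)

theorem Compat.symm {α V : Type} {G : RBStructure α} {H : Graph V} {u v : α} {a b : V}
    (h : Compat G H u v a b) : Compat G H v u b a :=
  ⟨h.2.2.1, h.2.2.2, h.1, h.2.1⟩

theorem Compat.of_imp {α V : Type} {G : RBStructure α} {H : Graph V} {u v : α} {a b c d : V}
    (h : Compat G H u v c d) (hR : H.R c d → H.R a b) (hB : H.B c d → H.B a b) :
    Compat G H u v a b :=
  ⟨fun e => hR (h.1 e), fun e => hB (h.2.1 e),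
    fun e => H.symm_R _ _ (hR (H.symm_R _ _ (h.2.2.1 e))),
    fun e => H.symm_B _ _ (hB (H.symm_B _ _ (h.2.2.2 e)))⟩

/-! ### Solutions from nonempty path consistent matrices -/

section Correctness

variable {α V : Type} [DecidableEq α] {E : α → α → SetRel V V} {G : RBStructure α} {H : Graph V}
  {lvl : V → ℕ}

/-- Between vertices of different maximal level all values of maximal level are compatible. -/
theorem compat_of_lvl_lt (hE : PathConsistent E) (hl : H.IsLevel lvl)
    (hG : ∀ u v a b, (a, b) ∈ E u v → Compat G H u v a b) {v w : α} {b c : V}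
    (hb : IsTop lvl E v b) (hc : IsTop lvl E w c) (h : lvl b < lvl c) : Compat G H v w b c := by
  obtain ⟨d, h1, h2⟩ := hE.exists_mem v hc.1
  have hd := hb.2 d (hE.mem_diag_right h1)
  -- Both `b` and `d` lie below `c`, so the loops of `c` decide both edges.
  refine (hG _ _ _ _ h2).of_imp (fun e => ?_) (fun e => ?_)
  · rw [hl.red_iff b c h, ← hl.red_iff d c (by omega)]; exact e
  · rw [hl.blue_iff b c h, ← hl.blue_iff d c (by omega)]; exact e

/-- If the value `a` at `u` leaves exactly one value at `v`, which has maximal level, then this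
value is compatible with all values of maximal level at each vertex `w` for which the value `a` at
`u` does not leave exactly one value that has maximal level. -/
theorem compat_of_forced (hE : PathConsistent E) (hl : H.IsLevel lvl)
    (hG : ∀ u v a b, (a, b) ∈ E u v → Compat G H u v a b) {u v w : α} {a b c : V}
    (ha : (a, a) ∈ E u u) (hb : IsTop lvl E v b) (hv : ∀ d, (a, d) ∈ E u v ↔ d = b)
    (hc : IsTop lvl E w c) (hw : ¬ ∃ d, IsTop lvl E w d ∧ ∀ e, (a, e) ∈ E u w ↔ e = d) :
    Compat G H v w b c := by
  rcases lt_trichotomy (lvl b) (lvl c) with h | h | h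
  · exact compat_of_lvl_lt hE hl hG hb hc h
  swap
  · exact (compat_of_lvl_lt hE hl hG hc hb h).symm
  obtain ⟨d, hd, -⟩ := hE.exists_mem w ha
  -- The triangle on `u`, `v`, `w` must use `b` at `v`, the only value that `a` leaves there.
  have hsupp : ∀ e, (a, e) ∈ E u w → Compat G H v w b e := by
    intro e he
    obtain ⟨f, h1, h2⟩ := hE.exists_mem v he
    obtain rfl := (hv f).1 h1
    exact hG _ _ _ _ h2
  have hle : ∀ e, (a, e) ∈ E u w → lvl e ≤ lvl b := fun e he =>
    h ▸ hc.2 e (hE.mem_diag_right he)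
  by_cases hac : (a, c) ∈ E u w
  · exact hsupp c hac
  have hdc : d ≠ c := fun e => hac (e ▸ hd)
  have htop : ∀ e, (a, e) ∈ E u w → lvl e = lvl b → IsTop lvl E w e := fun e he h1 =>
    ⟨hE.mem_diag_right he, fun f hf => (hc.2 f hf).trans (by omega)⟩
  -- Otherwise all values left at `w` share the level of `c`. This level has at most two vertices
  -- and `c` is not left, so a single top value remains and `w` is forced.
  have hlow : ∃ e, (a, e) ∈ E u w ∧ lvl e < lvl b := by
    by_contra! hcon
    have hlev : ∀ e, (a, e) ∈ E u w → lvl e = lvl b := fun e he =>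
      le_antisymm (hle e he) (hcon e he)
    refine hw ⟨d, htop d hd (hlev d hd), fun e => ⟨fun he => ?_, fun he => he ▸ hd⟩⟩
    rcases hl.two e d c ((hlev e he).trans (hlev d hd).symm) ((hlev d hd).trans h) with h1 | h1 | h1
    · exact h1
    · exact absurd h1 hdc
    · exact absurd he (h1 ▸ hac)
  obtain ⟨e, he, hlt⟩ := hlow
  -- As `e` lies below `b`, the constraints met by `b` and `e` give `b` the required loops, which
  -- settles `b = c`. If `b ≠ c`, their level is positive and they are joined in both colours.
  refine (hsupp e he).of_imp (fun h1 => ?_) (fun h1 => ?_)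
  · by_cases hbc : b = c
    · subst hbc; exact (hl.red_iff e b hlt).1 (H.symm_R _ _ h1)
    · exact (hl.star b c h (by omega) hbc).1
  · by_cases hbc : b = c
    · subst hbc; exact (hl.blue_iff e b hlt).1 (H.symm_B _ _ h1)
    · exact (hl.star b c h (by omega) hbc).2

theorem exists_assignment_on (hE : PathConsistent E) (hl : H.IsLevel lvl)
    (hG : ∀ u v a b, (a, b) ∈ E u v → Compat G H u v a b)
    (htop : ∀ u, ∃ a, IsTop lvl E u a) (U : Finset α) :
    ∃ s : α → V, (∀ u ∈ U, IsTop lvl E u (s u)) ∧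
      ∀ u ∈ U, ∀ v ∈ U, Compat G H u v (s u) (s v) := by
  classical
  induction U using Finset.strongInduction with
  | H U ih =>
    rcases U.eq_empty_or_nonempty with rfl | ⟨u, hu⟩
    · choose s hs using htop
      exact ⟨s, by simp, by simp⟩
    obtain ⟨a, ha⟩ := htop u
    let P : α → V → Prop := fun v d => IsTop lvl E v d ∧ ∀ e, (a, e) ∈ E u v ↔ e = d
    -- The vertex `u` is itself forced, so the unforced part of `U` is strictly smaller.
    have hPu : P u a := ⟨ha, fun e => ⟨fun h => (hE.eq_of_mem_diag h).symm, fun h => h ▸ ha.1⟩⟩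
    obtain ⟨s, hs1, hs2⟩ := ih (U.filter fun v => ¬ ∃ d, P v d)
      (Finset.filter_ssubset.2 ⟨u, hu, not_not.2 ⟨a, hPu⟩⟩)
    let t : α → V := fun v => if h : ∃ d, P v d then h.choose else s v
    have ht1 : ∀ v, (∃ d, P v d) → P v (t v) := by
      intro v h
      simp only [t, dif_pos h]
      exact h.choose_spec
    have ht2 : ∀ v, (¬ ∃ d, P v d) → t v = s v := fun v h => dif_neg h
    have htop' : ∀ v ∈ U, IsTop lvl E v (t v) := by
      intro v hv
      by_cases h : ∃ d, P v d
      · exact (ht1 v h).1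
      · rw [ht2 v h]; exact hs1 v (Finset.mem_filter.2 ⟨hv, h⟩)
    refine ⟨t, htop', fun v hv w hw => ?_⟩
    by_cases hPv : ∃ d, P v d <;> by_cases hPw : ∃ d, P w d
    -- Two forced vertices: the pair of `a` and the value at `w` extends to `v`, where only the
    -- forced value is available.
    · obtain ⟨c, h1, h2⟩ := hE.exists_mem v (((ht1 w hPw).2 (t w)).2 rfl)
      obtain rfl := ((ht1 v hPv).2 c).1 h1
      exact hG _ _ _ _ h2
    · exact compat_of_forced hE hl hG ha.1 (ht1 v hPv).1 (ht1 v hPv).2 (htop' w hw) hPw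
    · exact (compat_of_forced hE hl hG ha.1 (ht1 w hPw).1 (ht1 w hPw).2 (htop' v hv) hPv).symm
    · rw [ht2 v hPv, ht2 w hPw]
      exact hs2 v (Finset.mem_filter.2 ⟨hv, hPv⟩) w (Finset.mem_filter.2 ⟨hw, hPw⟩)

end Correctness

theorem ListInstance.preserves_initMatrix {V : Type} (I : ListInstance V) (H : Graph V)
    {f : Fin I.n → V} (hf : IsHom I.G H.toRBStructure f) (hL : ∀ u, f u ∈ I.L u) :
    Preserves f (I.initMatrix H) := fun u v =>
  ⟨hL u, fun h => hf.1 u v (by simpa using h), fun h => hf.2 u v (by simpa using h)⟩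

/-- A nonempty path consistent submatrix of the initial matrix yields a solution. -/
theorem ListInstance.isYes_of_pathConsistent {V : Type} [Finite V] {H : Graph V} {lvl : V → ℕ}
    (hl : H.IsLevel lvl) (I : ListInstance V) {E : Fin I.n → Fin I.n → SetRel V V}
    (hE : PathConsistent E) (hle : E ≤ I.initMatrix H) (hne : ∀ u, (E u u).Nonempty) :
    I.IsYes H := by
  have hG : ∀ u v a b, (a, b) ∈ E u v → Compat I.G H u v a b := by
    intro u v a b h
    have h1 := hle u v h
    -- The edges from `v` to `u` are recorded only in the transposed entry.
    have h2 := hle v u (hE.symm h)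
    exact ⟨fun e => h1.2.1 (by simpa using e), fun e => h1.2.2 (by simpa using e),
      fun e => h2.2.1 (by simpa using e), fun e => h2.2.2 (by simpa using e)⟩
  have htop : ∀ u, ∃ a, IsTop lvl E u a := by
    intro u
    obtain ⟨a, ha, h⟩ := Set.exists_max_image {a | (a, a) ∈ E u u} lvl (Set.toFinite _)
      (hE.exists_mem_diag (hne u) u)
    exact ⟨a, ha, h⟩
  obtain ⟨s, hs1, hs2⟩ := exists_assignment_on hE hl hG htop Finset.univ
  exact ⟨s, ⟨fun u v h => (hs2 u (Finset.mem_univ u) v (Finset.mem_univ v)).1 h,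
    fun u v h => (hs2 u (Finset.mem_univ u) v (Finset.mem_univ v)).2.1 h⟩,
    fun u => (hle u u (hs1 u (Finset.mem_univ u)).1).1⟩

/-! ### Step counting -/

/-- `f` leads from `a` to `b` in at most `t` steps. -/
def ReachesIn {σ : Type} (f : σ → Option σ) (a b : σ) (t : ℕ) : Prop :=
  Nonempty (EvalsToInTime f a (some b) t)

namespace ReachesIn

variable {σ : Type} {f : σ → Option σ} {a b c : σ} {s t : ℕ}

theorem refl (f : σ → Option σ) (a : σ) : ReachesIn f a a 0 :=
  ⟨EvalsToInTime.refl f a⟩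

theorem trans (h₁ : ReachesIn f a b s) (h₂ : ReachesIn f b c t) : ReachesIn f a c (s + t) := by
  obtain ⟨h₁⟩ := h₁
  obtain ⟨h₂⟩ := h₂
  rw [add_comm]
  exact ⟨EvalsToInTime.trans f s t a b (some c) h₁ h₂⟩

theorem mono (h : ReachesIn f a b s) (hst : s ≤ t) : ReachesIn f a b t := by
  obtain ⟨h⟩ := h
  exact ⟨⟨h.toEvalsTo, h.steps_le_m.trans hst⟩⟩

theorem single (h : f a = some b) : ReachesIn f a b 1 :=
  ⟨⟨⟨1, h⟩, le_rfl⟩⟩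

theorem cons (h : ReachesIn f b c t) (h₁ : f a = some b) : ReachesIn f a c (t + 1) :=
  ((single h₁).trans h).mono (by omega)

end ReachesIn

/-! ### The machine -/

/-- The stacks of the machine. -/
inductive Stack
  | inp | w1 | w2 | a1 | a2 | aux | out
  deriving DecidableEq

instance : Fintype Stack :=
  ⟨{.inp, .w1, .w2, .a1, .a2, .aux, .out}, fun k => by cases k <;> decide⟩

/-- The labels of the machine. -/
inductive Label
  | init | head | row | split | col | body | restore | emit | back | answer | clear
  deriving DecidableEq

instance : Fintype Label :=
  ⟨{.init, .head, .row, .split, .col, .body, .restore, .emit, .back, .answer, .clear},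
    fun l => by cases l <;> decide⟩

/-- The symbols by which a matrix is written down row by row: relations, and marks at the ends of
the rows. -/
abbrev MatrixSymbol (V : Type) : Type := SetRel V V ⊕ Bool

/-- The stack alphabets of the machine. -/
def Alphabet (V : Type) : Stack → Type
  | .inp => InputSymbol V
  | .w1 | .w2 => MatrixSymbol V
  | .a1 | .a2 | .aux => SetRel V V
  | .out => Bool

open scoped Classical in
/-- Whether the relation `T` differs from the relation `S`. -/
noncomputable def changes {V : Type} (S T : SetRel V V) : Bool := decide (T ≠ S)

/-- The internal states of the machine. -/
@[ext]
structure State (V : Type) where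
  sym : Option (MatrixSymbol V)
  rel : SetRel V V
  diag : SetRel V V
  first : SetRel V V
  mark : Bool
  changed : Bool
  list : Set V

namespace State

variable {V : Type}

/-- The state with empty registers. -/
abbrev idle (d x : SetRel V V) (mk ch : Bool) (L : Set V) : State V :=
  ⟨none, ∅, d, x, mk, ch, L⟩

/-- The initial state. -/
abbrev start : State V := idle ∅ ∅ true false ∅

def cell (s : State V) : SetRel V V :=
  match s.sym with
  | some (.inl S) => S
  | _ => ∅

def readMark (s : State V) : Bool :=
  match s.sym with
  | some (.inr b) => b
  | _ => false

def isCell (s : State V) : Bool :=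
  match s.sym with
  | some (.inl _) => true
  | _ => false

/-- Applied before each jump to another label, so that the states between steps have the form
`idle`. -/
def clean (s : State V) : State V := { s with sym := none, rel := ∅ }

def read (s : State V) (o : Option (MatrixSymbol V)) : State V := { s with sym := o }

def readCell (s : State V) (o : Option (SetRel V V)) : State V := { s with sym := o.map .inl }

def readRel (s : State V) (o : Option (SetRel V V)) : State V := { s with rel := o.getD ∅ }

/-- A vertex symbol turns into the mark of its row: it is read before the cells, so on the stack it
lies below them, at the end of the row. -/
def readInput (H : Graph V) (s : State V) : Option (InputSymbol V) → State V
  | some (.vertex L) => { s with sym := some (.inr s.mark), list := L }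
  | some (.pair r b) => { s with sym := some (.inl (initRel H s.list r b)) }
  | none => { s with sym := none }

/-- Record a possible change from `S` to `T`. -/
noncomputable def record (s : State V) (S T : SetRel V V) : State V :=
  { s with changed := s.changed || changes S T }

end State

open TM2.Stmt in
open scoped Classical in
/-- The program: path consistency by pivot steps at the first row of the matrix on the stack `w1`,
which is then moved to the end, until no relation changes between two pivot steps at the row with
the mark `true`. -/
noncomputable def program {V : Type} (H : Graph V) :
    Label → TM2.Stmt (Alphabet V) Label (State V)
  | .init =>
    pop .inp (State.readInput H) <|
    branch (fun s => s.sym.isSome)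
      (push .w1 (fun s => s.sym.getD (.inr false)) <|
        -- The first vertex symbol switches the mark off for good, so only the row of vertex `0`, at
        -- the bottom of the stack, is marked `true`.
        load (fun s => { s.clean with mark := s.isCell && s.mark }) <| goto fun _ => .init)
      (load State.clean <| goto fun _ => .head)
  | .head =>
    pop .w1 State.read <|
    branch State.isCell
      (load (fun s =>
          { s.clean.record s.cell (s.cell ∩ SetRel.id) with diag := s.cell ∩ SetRel.id }) <|
        goto fun _ => .row)
      -- No row at all: the instance is empty and the answer is yes.
      (push .out (fun _ => true) <| load (fun _ => State.start) halt)
  | .row =>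
    pop .w1 State.read <|
    branch State.isCell
      (push .aux (fun s => (s.cell ∩ (s.diag ○ s.cell) : SetRel V V)) <|
        load (fun s => s.clean.record s.cell (s.cell ∩ (s.diag ○ s.cell))) <| goto fun _ => .row)
      (load (fun s => { s.clean with mark := s.readMark }) <| goto fun _ => .split)
  | .split =>
    pop .aux State.readCell <|
    branch State.isCell
      -- The copy on `a2` is used up, one entry per row; the copy on `a1` is traversed in every row
      -- and restored from `aux`.
      (push .a1 State.cell <| push .a2 State.cell <| load State.clean <| goto fun _ => .split)
      (load State.clean <| goto fun _ => .col)
  | .col =>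
    pop .w1 State.read <|
    branch State.isCell
      (pop .a2 State.readRel <|
        load (fun s =>
          { s.clean.record s.cell (s.cell ∩ s.rel.inv) with first := s.cell ∩ s.rel.inv }) <|
        goto fun _ => .body)
      (load State.clean <| goto fun _ => .emit)
  | .body =>
    pop .w1 State.read <|
    branch State.isCell
      (pop .a1 State.readRel <|
        push .w2 (fun s => .inl (s.cell ∩ (s.first ○ s.rel))) <| push .aux State.rel <|
        load (fun s => s.clean.record s.cell (s.cell ∩ (s.first ○ s.rel))) <| goto fun _ => .body)
      -- The pivot column moves to the end of the row.
      (push .w2 (fun s => .inl s.first) <| push .w2 (fun s => .inr s.readMark) <|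
        load State.clean <| goto fun _ => .restore)
  | .restore =>
    pop .aux State.readCell <|
    branch State.isCell
      (push .a1 State.cell <| load State.clean <| goto fun _ => .restore)
      (load State.clean <| goto fun _ => .col)
  | .emit =>
    pop .a1 State.readCell <|
    branch State.isCell
      (push .w2 (fun s => .inl s.cell) <| load State.clean <| goto fun _ => .emit)
      (push .w2 (fun s => .inl s.diag) <| push .w2 (fun s => .inr s.mark) <|
        load State.clean <| goto fun _ => .back)
  | .back =>
    pop .w2 State.read <|
    branch (fun s => s.sym.isSome)
      (push .w1 (fun s => s.sym.getD (.inr false)) <| load State.clean <| goto fun _ => .back)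
      (branch (fun s => s.mark && !s.changed)
        (load State.clean <| goto fun _ => .answer)
        (load (fun s => { s.clean with changed := s.changed && !s.mark }) <| goto fun _ => .head))
  | .answer =>
    pop .w1 State.read <| push .out (fun s => decide s.cell.Nonempty) <|
    load State.clean <| goto fun _ => .clear
  | .clear =>
    pop .w1 State.read <|
    branch (fun s => s.sym.isSome)
      (load State.clean <| goto fun _ => .clear)
      (load (fun _ => State.start) halt)

/-! ### Runs of the single loops of the program -/

section Steps

variable {V : Type} (H : Graph V)

/-- The contents of the stacks. -/
def stackContents (i : List (InputSymbol V)) (w₁ w₂ : List (MatrixSymbol V)) (a₁ a₂ y : List (SetRel V V))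
    (o : List Bool) : ∀ k, List (Alphabet V k)
  | .inp => i
  | .w1 => w₁
  | .w2 => w₂
  | .a1 => a₁
  | .a2 => a₂
  | .aux => y
  | .out => o

/-- A configuration of the machine. -/
abbrev config (l : Option Label) (s : State V) (i : List (InputSymbol V))
    (w₁ w₂ : List (MatrixSymbol V)) (a₁ a₂ y : List (SetRel V V)) (o : List Bool) :
    TM2.Cfg (Alphabet V) Label (State V) :=
  ⟨l, s, stackContents i w₁ w₂ a₁ a₂ y o⟩

/-- The machine leads from one configuration to another one in at most `t` steps. -/
abbrev Runs (c c' : TM2.Cfg (Alphabet V) Label (State V)) (t : ℕ) : Prop :=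
  ReachesIn (TM2.step (program H)) c c' t

variable {H}

/-- Comparing the stacks one by one lets each concrete step be checked by computation. -/
theorem step_eq_some {l : Label} {s : State V} {S : ∀ k, List (Alphabet V k)}
    {c : TM2.Cfg (Alphabet V) Label (State V)} (hl : (TM2.stepAux (program H l) s S).l = c.l)
    (hv : (TM2.stepAux (program H l) s S).var = c.var)
    (hS : ∀ k, (TM2.stepAux (program H l) s S).stk k = c.stk k) :
    TM2.step (program H) ⟨some l, s, S⟩ = some c := by
  rw [TM2.step]
  congr 1
  cases c
  have := funext hS
  generalize TM2.stepAux (program H l) s S = c' at *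
  cases c'
  simp_all

variable {d x : SetRel V V} {mk ch : Bool} {L : Set V} {i : List (InputSymbol V)}
  {w₁ w₂ : List (MatrixSymbol V)} {a₁ a₂ y : List (SetRel V V)} {o : List Bool}

theorem runs_init_cells {ι : Type} (r b : ι → Bool) (m : List ι) :
    Runs H
      (config (some .init) (.idle d x mk ch L) (m.map (fun v => .pair (r v) (b v)) ++ i) w₁ w₂ a₁ a₂
        y o)
      (config (some .init) (.idle d x mk ch L) i
        ((m.map fun v => .inl (initRel H L (r v) (b v))).reverse ++ w₁) w₂ a₁ a₂ y o)
      m.length := by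
  induction m generalizing w₁ with
  | nil => exact .refl _ _
  | cons v m ih =>
    simp only [List.map_cons, List.reverse_cons, List.append_assoc]
    exact ih.cons (step_eq_some rfl rfl fun k => by cases k <;> rfl)

theorem runs_row {ι : Type} (P : ι → SetRel V V) (m : List ι) (b : Bool) :
    Runs H
      (config (some .row) (.idle d x mk ch L) i (m.map (fun v => .inl (P v)) ++ .inr b :: w₁) w₂
        a₁ a₂ y o)
      (config (some .split)
        (.idle d x b (ch || m.any fun v => changes (P v) (P v ∩ (d ○ P v))) L) i w₁ w₂ a₁ a₂
        ((m.map fun v => P v ∩ (d ○ P v)).reverse ++ y) o) (m.length + 1) := by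
  induction m generalizing ch y with
  | nil =>
    simp only [List.any_nil, Bool.or_false]
    exact .single (step_eq_some rfl rfl fun k => by cases k <;> rfl)
  | cons v m ih =>
    simp only [List.any_cons, ← Bool.or_assoc, List.map_cons, List.reverse_cons, List.append_assoc]
    exact ih.cons (step_eq_some rfl rfl fun k => by cases k <;> rfl)

theorem runs_split :
    Runs H
      (config (some .split) (.idle d x mk ch L) i w₁ w₂ a₁ a₂ y o)
      (config (some .col) (.idle d x mk ch L) i w₁ w₂ (y.reverse ++ a₁) (y.reverse ++ a₂) [] o)
      (y.length + 1) := by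
  induction y generalizing a₁ a₂ with
  | nil => exact .single (step_eq_some rfl rfl fun k => by cases k <;> rfl)
  | cons S y ih =>
    simp only [List.reverse_cons, List.append_assoc]
    exact ih.cons (step_eq_some rfl rfl fun k => by cases k <;> rfl)

theorem runs_body {ι : Type} (P Q : ι → SetRel V V) (m : List ι) (b : Bool) :
    Runs H
      (config (some .body) (.idle d x mk ch L) i (m.map (fun v => .inl (P v)) ++ .inr b :: w₁) w₂
        (m.map Q) a₂ y o)
      (config (some .restore)
        (.idle d x mk (ch || m.any fun v => changes (P v) (P v ∩ (x ○ Q v))) L) i w₁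
        (.inr b :: .inl x :: ((m.map fun v => .inl (P v ∩ (x ○ Q v))).reverse ++ w₂)) [] a₂
        ((m.map Q).reverse ++ y) o) (m.length + 1) := by
  induction m generalizing ch w₂ y with
  | nil =>
    simp only [List.any_nil, Bool.or_false]
    exact .single (step_eq_some rfl rfl fun k => by cases k <;> rfl)
  | cons v m ih =>
    simp only [List.any_cons, ← Bool.or_assoc, List.map_cons, List.reverse_cons, List.append_assoc]
    exact ih.cons (step_eq_some rfl rfl fun k => by cases k <;> rfl)

theorem runs_restore :
    Runs H
      (config (some .restore) (.idle d x mk ch L) i w₁ w₂ a₁ a₂ y o)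
      (config (some .col) (.idle d x mk ch L) i w₁ w₂ (y.reverse ++ a₁) a₂ [] o)
      (y.length + 1) := by
  induction y generalizing a₁ with
  | nil => exact .single (step_eq_some rfl rfl fun k => by cases k <;> rfl)
  | cons S y ih =>
    simp only [List.reverse_cons, List.append_assoc]
    exact ih.cons (step_eq_some rfl rfl fun k => by cases k <;> rfl)

theorem runs_emit :
    Runs H
      (config (some .emit) (.idle d x mk ch L) i w₁ w₂ a₁ a₂ y o)
      (config (some .back) (.idle d x mk ch L) i w₁
        (.inr mk :: .inl d :: ((a₁.map .inl).reverse ++ w₂)) [] a₂ y o)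
      (a₁.length + 1) := by
  induction a₁ generalizing w₂ with
  | nil => exact .single (step_eq_some rfl rfl fun k => by cases k <;> rfl)
  | cons S a₁ ih =>
    simp only [List.map_cons, List.reverse_cons, List.append_assoc]
    exact ih.cons (step_eq_some rfl rfl fun k => by cases k <;> rfl)

theorem runs_back :
    Runs H
      (config (some .back) (.idle d x mk ch L) i w₁ w₂ a₁ a₂ y o)
      (config (some (if mk && !ch then .answer else .head)) (.idle d x mk (ch && !mk) L) i
        (w₂.reverse ++ w₁) [] a₁ a₂ y o)
      (w₂.length + 1) := by
  induction w₂ generalizing w₁ with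
  | nil =>
    cases mk <;> cases ch <;> exact .single (step_eq_some rfl rfl fun k => by cases k <;> rfl)
  | cons S w₂ ih =>
    simp only [List.reverse_cons, List.append_assoc]
    exact ih.cons (step_eq_some rfl rfl fun k => by cases k <;> rfl)

theorem runs_clear :
    Runs H
      (config (some .clear) (.idle d x mk ch L) i w₁ w₂ a₁ a₂ y o)
      (config none .start i [] w₂ a₁ a₂ y o)
      (w₁.length + 1) := by
  induction w₁ with
  | nil => exact .single (step_eq_some rfl rfl fun k => by cases k <;> rfl)
  | cons S w₁ ih =>
    exact ih.cons (step_eq_some rfl rfl fun k => by cases k <;> rfl)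

open scoped Classical in
theorem runs_answer (S : SetRel V V) :
    Runs H
      (config (some .answer) (.idle d x mk ch L) i (.inl S :: w₁) w₂ a₁ a₂ y o)
      (config none .start i [] w₂ a₁ a₂ y (decide S.Nonempty :: o))
      (w₁.length + 2) :=
  ReachesIn.cons (runs_clear (d := d) (x := x) (mk := mk) (ch := ch) (L := L))
    (step_eq_some rfl rfl fun k => by cases k <;> rfl)

/-! ### Matrices as words -/

section Matrix

variable {α : Type}

/-- Whether a step from `E` to `E'` changes a relation between the vertices of a list. -/
noncomputable def changesOn (l : List α) (E E' : α → α → SetRel V V) : Bool :=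
  l.any fun u => l.any fun v => changes (E u v) (E' u v)

theorem changesOn_eq_false_iff {l : List α} (hl : ∀ u, u ∈ l) {E E' : α → α → SetRel V V} :
    changesOn l E E' = false ↔ E' = E := by
  simp [changesOn, changes, List.any_eq_false, hl, funext_iff]

/-- The number of triples of two vertices and a pair of values that survives. -/
noncomputable def weight (E : α → α → SetRel V V) : ℕ :=
  {p : α × α × V × V | p.2.2 ∈ E p.1 p.2.1}.ncard

theorem weight_lt_weight [Finite α] [Finite V] {E E' : α → α → SetRel V V} (h : E' < E) :
    weight E' < weight E := by
  refine Set.ncard_lt_ncard (lt_of_le_of_ne (fun p hp => h.le _ _ hp) fun he => h.ne ?_)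
    (Set.toFinite _)
  funext u v
  ext p
  exact Set.ext_iff.1 he (u, v, p)

theorem weight_le [Finite α] [Finite V] (E : α → α → SetRel V V) :
    weight E ≤ Nat.card α * (Nat.card α * Nat.card (V × V)) := by
  rw [← Nat.card_prod, ← Nat.card_prod]
  exact Set.ncard_le_card _

variable [DecidableEq α]

theorem foldl_pivot_le (l : List α) (E : α → α → SetRel V V) : l.foldl pivot E ≤ E := by
  induction l generalizing E with
  | nil => exact le_rfl
  | cons w l ih => exact (ih _).trans (pivot_le E w)

/-- Pivot steps only shrink the matrix, so a sequence that returns to `E` never left it. -/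
theorem pivot_eq_of_foldl_eq {l : List α} {E : α → α → SetRel V V} (h : l.foldl pivot E = E) {w : α}
    (hw : w ∈ l) : pivot E w = E := by
  induction l with
  | nil => simp at hw
  | cons v l ih =>
    have hv : pivot E v = E :=
      le_antisymm (pivot_le E v) (h.symm.le.trans (foldl_pivot_le l (pivot E v)))
    rw [List.foldl_cons, hv] at h
    rcases List.mem_cons.1 hw with rfl | hw
    · exact hv
    · exact ih h hw

theorem Preserves.foldl_pivot {s : α → V} (l : List α) {E : α → α → SetRel V V}
    (h : Preserves s E) : Preserves s (l.foldl TwoEC.pivot E) := by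
  induction l generalizing E with
  | nil => exact h
  | cons w l ih => exact ih (h.pivot w)

/-- The row `u` of a matrix, with its columns in the order `m`. -/
def matrixRow (z : α) (E : α → α → SetRel V V) (m : List α) (u : α) : List (MatrixSymbol V) :=
  m.map (fun v => .inl (E u v)) ++ [.inr (decide (u = z))]

/-- A matrix, with its rows in the order `l` and its columns in the order `m`. -/
def matrixWord (z : α) (E : α → α → SetRel V V) (l m : List α) : List (MatrixSymbol V) :=
  l.flatMap (matrixRow z E m)

theorem length_matrixWord (z : α) (E : α → α → SetRel V V) (l m : List α) :
    (matrixWord z E l m).length = l.length * (m.length + 1) := by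
  simp [matrixWord, matrixRow, List.length_flatMap]

theorem any_congr_of_mem {ι : Type} {m : List ι} {p q : ι → Bool} (h : ∀ v ∈ m, p v = q v) :
    m.any p = m.any q := by
  induction m with
  | nil => rfl
  | cons v m ih => simp_all

/-! ### Pivot steps and rounds on the machine -/

theorem runs_col_row (E : α → α → SetRel V V) (z w u : α) (m : List α) (hu : u ≠ w) (hm : w ∉ m) :
    Runs H
      (config (some .col) (.idle d x mk ch L) i (matrixRow z E (w :: m) u ++ w₁) w₂
        (m.map (pivotRow E w)) (pivotRow E w u :: a₂) [] o)
      (config (some .col)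
        (.idle d (pivotCol E w u) mk
          (ch || (w :: m).any fun v => changes (E u v) (pivot E w u v)) L)
        i w₁ ((matrixRow z (pivot E w) (m ++ [w]) u).reverse ++ w₂) (m.map (pivotRow E w)) a₂ [] o)
      (2 * m.length + 3) := by
  have hcol : pivot E w u w = pivotCol E w u := by simp [pivot, hu]
  have hpiv : ∀ v ∈ m, E u v ∩ (pivotCol E w u ○ pivotRow E w v) = pivot E w u v := by
    intro v hv
    simp [pivot, hu, ne_of_mem_of_not_mem hv hm]
  have h1 := runs_body (H := H) (d := d) (x := pivotCol E w u) (mk := mk)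
    (ch := ch || changes (E u w) (pivotCol E w u)) (L := L) (i := i) (y := []) (o := o)
    (w₁ := w₁) (w₂ := w₂) (a₂ := a₂) (E u) (pivotRow E w) m (decide (u = z))
  rw [List.map_congr_left fun v hv => congrArg Sum.inl (hpiv v hv),
    any_congr_of_mem fun v hv => congrArg _ (hpiv v hv)] at h1
  -- The additional first step computes the entry in the pivot column from the top of `a2`.
  have h2 := (h1.trans runs_restore).cons (a := config (some .col) (.idle d x mk ch L) i
    (matrixRow z E (w :: m) u ++ w₁) w₂ (m.map (pivotRow E w)) (pivotRow E w u :: a₂) [] o)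
    (step_eq_some rfl rfl fun k => by cases k <;> first | rfl | (simp [matrixRow]; rfl))
  convert h2.mono _ using 2
  · simp [hcol, Bool.or_assoc]
  · simp [matrixRow, hcol]
  · simp
  · simp; omega

theorem runs_cols (E : α → α → SetRel V V) (z w : α) (l m : List α) (hl : w ∉ l) (hm : w ∉ m) :
    ∃ x', Runs H
      (config (some .col) (.idle d x mk ch L) i (matrixWord z E l (w :: m)) w₂
        (m.map (pivotRow E w)) (l.map (pivotRow E w)) [] o)
      (config (some .emit)
        (.idle d x' mk
          (ch || l.any fun u => (w :: m).any fun v => changes (E u v) (pivot E w u v)) L)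
        i [] ((matrixWord z (pivot E w) l (m ++ [w])).reverse ++ w₂) (m.map (pivotRow E w)) [] [] o)
      (l.length * (2 * m.length + 3) + 1) := by
  induction l generalizing x ch w₂ with
  | nil =>
    refine ⟨x, ?_⟩
    simp only [List.any_nil, Bool.or_false, matrixWord, List.flatMap_nil, List.map_nil,
      List.length_nil, zero_mul, zero_add]
    exact .single (step_eq_some rfl rfl fun k => by cases k <;> rfl)
  | cons u l ih =>
    obtain ⟨hu, hl⟩ := not_or.1 (mt List.mem_cons.2 hl)
    obtain ⟨x', h⟩ := ih (x := pivotCol E w u)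
      (ch := ch || (w :: m).any fun v => changes (E u v) (pivot E w u v))
      (w₂ := (matrixRow z (pivot E w) (m ++ [w]) u).reverse ++ w₂) hl
    refine ⟨x', ?_⟩
    rw [List.any_cons (l := l), ← Bool.or_assoc]
    simp only [matrixWord, List.flatMap_cons, List.reverse_append, List.append_assoc,
      List.length_cons, List.map_cons (l := l)]
    exact ((runs_col_row E z w u m (Ne.symm hu) hm).trans h).mono (by ring_nf; rfl)

/-- The pivot row and column move to the end, so repeated steps at the head visit the vertices
cyclically. -/
theorem runs_pivot (E : α → α → SetRel V V) (z w : α) (l : List α) (hl : w ∉ l) :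
    ∃ d' x', Runs H
      (config (some .head) (.idle d x mk ch L) i (matrixWord z E (w :: l) (w :: l)) [] [] [] [] o)
      (config
        (some (if decide (w = z) && !(ch || changesOn (w :: l) E (pivot E w)) then .answer else .head))
        (.idle d' x' (decide (w = z))
          ((ch || changesOn (w :: l) E (pivot E w)) && !decide (w = z)) L)
        i (matrixWord z (pivot E w) (l ++ [w]) (l ++ [w])) [] [] [] [] o)
      (4 * ((l.length + 1) * (l.length + 2))) := by
  have hdiag : pivot E w w w = E w w ∩ SetRel.id := by simp [pivot, pivotRow]
  have hrow : ∀ v ∈ l, E w v ∩ ((E w w ∩ SetRel.id) ○ E w v) = pivot E w w v := by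
    intro v hv
    simp [pivot, pivotRow, ne_of_mem_of_not_mem hv hl]
  have hrow' : pivot E w w = pivotRow E w := by funext v; simp [pivot]
  have h1 := runs_row (H := H) (d := E w w ∩ SetRel.id) (x := x) (mk := mk)
    (ch := ch || changes (E w w) (E w w ∩ SetRel.id)) (L := L) (i := i)
    (w₁ := matrixWord z E l (w :: l)) (w₂ := []) (a₁ := []) (a₂ := []) (y := []) (o := o)
    (E w) l (decide (w = z))
  rw [List.map_congr_left hrow, any_congr_of_mem fun v hv => congrArg _ (hrow v hv)] at h1
  have h2 := (h1.trans runs_split).cons (a := config (some .head) (.idle d x mk ch L) i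
    (matrixWord z E (w :: l) (w :: l)) [] [] [] [] o)
    (step_eq_some rfl rfl fun k => by
      cases k <;> first | rfl | (simp [matrixWord, matrixRow]; rfl))
  rw [List.append_nil, List.append_nil, List.reverse_reverse, ← hdiag, Bool.or_assoc] at h2
  obtain ⟨x', h3⟩ := runs_cols (H := H) (d := pivot E w w w) (x := x) (mk := decide (w = z))
    (ch := ch || (w :: l).any fun v => changes (E w v) (pivot E w w v)) (L := L) (i := i) (w₂ := [])
    (o := o) E z w l l hl hl
  rw [← hrow'] at h3
  have h4 := (h2.trans h3).trans (runs_emit.trans runs_back)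
  refine ⟨pivot E w w w, x', ?_⟩
  convert h4.mono _ using 2
  · simp [changesOn, Bool.or_assoc]
  · simp [changesOn, Bool.or_assoc]
  · simp [matrixWord, matrixRow, hrow']
  -- With `l.length = k` the phases add up to `3k² + 9k + 8` steps.
  · simp [length_matrixWord]
    ring_nf
    nlinarith

/-- Induction on the vertices `l₂` still ahead of `z`; those already treated accumulate in `l₁`. The
round ends with the pivot at `z`, where the change flag is tested and reset. -/
theorem runs_round (E : α → α → SetRel V V) (z : α) (l₁ l₂ : List α)
    (hnd : (l₂ ++ z :: l₁).Nodup) (hall : ∀ u, u ∈ l₂ ++ z :: l₁) {n : ℕ}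
    (hn : (l₂ ++ z :: l₁).length = n) :
    ∃ d' x' ch', (ch' = false ↔ ch = false ∧ (l₂ ++ [z]).foldl pivot E = E) ∧ Runs H
      (config (some .head) (.idle d x mk ch L) i (matrixWord z E (l₂ ++ z :: l₁) (l₂ ++ z :: l₁))
        [] [] [] [] o)
      (config (some (if ch' then .head else .answer)) (.idle d' x' true false L) i
        (matrixWord z ((l₂ ++ [z]).foldl pivot E) (l₁ ++ l₂ ++ [z]) (l₁ ++ l₂ ++ [z])) [] [] [] [] o)
      ((l₂.length + 1) * (4 * (n * (n + 1)))) := by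
  induction l₂ generalizing E l₁ d x mk ch with
  | nil =>
    obtain ⟨d', x', h⟩ := runs_pivot (H := H) (d := d) (x := x) (mk := mk) (ch := ch) (L := L)
      (i := i) (o := o) E z z l₁ (List.nodup_cons.1 hnd).1
    refine ⟨d', x', ch || changesOn (z :: l₁) E (pivot E z), ?_, ?_⟩
    · simp [changesOn_eq_false_iff (l := z :: l₁) hall]
    · subst hn
      convert h.mono _ using 2
      · rfl
      · cases ch <;> cases changesOn (z :: l₁) E (pivot E z) <;> simp
      · simp
      · simp
      · simp
  | cons w l₂ ih =>
    have hperm : (w :: (l₂ ++ z :: l₁)).Perm (l₂ ++ z :: (l₁ ++ [w])) := by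
      simpa using (List.perm_append_singleton w (l₂ ++ z :: l₁)).symm
    have hw := (List.nodup_cons.1 hnd).1
    have hwz : w ≠ z := fun h => hw (by simp [h])
    obtain ⟨d₁, x₁, h⟩ := runs_pivot (H := H) (d := d) (x := x) (mk := mk) (ch := ch) (L := L)
      (i := i) (o := o) E z w (l₂ ++ z :: l₁) hw
    obtain ⟨d', x', ch', hch, h'⟩ := ih (d := d₁) (x := x₁) (mk := false)
      (ch := ch || changesOn (w :: (l₂ ++ z :: l₁)) E (pivot E w)) (pivot E w) (l₁ ++ [w])
      (hperm.nodup_iff.1 hnd) (fun u => hperm.mem_iff.1 (hall u)) (hperm.length_eq.symm.trans hn)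
    refine ⟨d', x', ch', ?_, ?_⟩
    · rw [hch, Bool.or_eq_false_iff, changesOn_eq_false_iff (l := w :: (l₂ ++ z :: l₁)) hall,
        List.cons_append, List.foldl_cons, and_assoc]
      refine and_congr_right fun _ => ⟨fun ⟨h1, h2⟩ => h2.trans h1, fun h1 => ?_⟩
      have h2 : pivot E w = E := pivot_eq_of_foldl_eq (l := w :: (l₂ ++ [z])) h1 (by simp)
      exact ⟨h2, h1.trans h2.symm⟩
    · subst hn
      simp only [decide_eq_false hwz, Bool.false_and, Bool.not_false, Bool.and_true] at h
      have h2 := h.trans (by simpa using h')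
      convert h2.mono _ using 2
      · rfl
      · simp
      · simp only [List.length_cons, List.length_append, List.cons_append]
        exact le_of_eq (by ring)

/-- Each round that changes a relation lowers the weight, so there are at most `weight E + 1`
rounds. -/
theorem runs_loop [Finite α] [Finite V] (E : α → α → SetRel V V) (z : α) (l : List α)
    (hnd : (l ++ [z]).Nodup) (hall : ∀ u, u ∈ l ++ [z]) {n : ℕ} (hn : (l ++ [z]).length = n) :
    ∃ E' : α → α → SetRel V V, PathConsistent E' ∧ E' ≤ E ∧
      (∀ s, Preserves s E → Preserves s E') ∧
      ∃ d' x', Runs H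
        (config (some .head) (.idle d x mk false L) i (matrixWord z E (l ++ [z]) (l ++ [z]))
          [] [] [] [] o)
        (config (some .answer) (.idle d' x' true false L) i
          (matrixWord z E' (l ++ [z]) (l ++ [z])) [] [] [] [] o)
        ((weight E + 1) * (n * (4 * (n * (n + 1))))) := by
  induction hE : weight E using Nat.strong_induction_on generalizing E d x mk with
  | h k ih =>
    subst hE
    obtain ⟨d', x', ch', hch, h⟩ := runs_round (H := H) (d := d) (x := x) (mk := mk) (ch := false)
      (L := L) (i := i) (o := o) E z [] l hnd hall hn
    have hlen : l.length + 1 = n := by simpa using hn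
    rw [List.nil_append, hlen] at h
    cases ch' with
    | false =>
      have heq := (hch.1 rfl).2
      rw [heq] at h
      exact ⟨E, fun w => pivot_eq_of_foldl_eq heq (hall w), le_rfl, fun _ => id, d', x',
        h.mono (Nat.le_mul_of_pos_left _ (Nat.succ_pos _))⟩
    | true =>
      have hlt : (l ++ [z]).foldl pivot E < E :=
        lt_of_le_of_ne (foldl_pivot_le _ _) fun he => by simpa using hch.2 ⟨rfl, he⟩
      have hw := weight_lt_weight hlt
      obtain ⟨E', h1, h2, h3, d₂, x₂, h4⟩ := ih _ hw (d := d') (x := x') (mk := true) _ rfl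
      refine ⟨E', h1, h2.trans hlt.le, fun s hs => h3 s (hs.foldl_pivot _), d₂, x₂,
        (h.trans h4).mono ?_⟩
      nlinarith [Nat.mul_le_mul_right (n * (4 * (n * (n + 1)))) hw]

/-! ### Reading the input -/

theorem runs_init_row (Ls : α → Set V) (r b : α → α → Bool) (z u : α) (m : List α)
    (hmk : mk = decide (u = z)) :
    Runs H
      (config (some .init) (.idle d x mk ch L)
        (.vertex (Ls u) :: (m.map (fun v => .pair (r u v) (b u v)) ++ i)) w₁ w₂ a₁ a₂ y o)
      (config (some .init) (.idle d x false ch (Ls u)) i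
        (matrixRow z (fun u v => initRel H (Ls u) (r u v) (b u v)) m.reverse u ++ w₁) w₂ a₁ a₂ y o)
      (m.length + 1) := by
  subst hmk
  simp only [matrixRow, List.map_reverse, List.append_assoc]
  exact (runs_init_cells (r u) (b u) m).cons (step_eq_some rfl rfl fun k => by cases k <;> rfl)

/-- Covers the rows after the first, whose marks are `false`. Pushing reverses the order of both
rows and columns. -/
theorem runs_init_rows (Ls : α → Set V) (r b : α → α → Bool) (z : α) (l m : List α) (hz : z ∉ l) :
    ∃ L', Runs H
      (config (some .init) (.idle d x false ch L)
        (l.flatMap fun u => .vertex (Ls u) :: m.map fun v => .pair (r u v) (b u v)) w₁ w₂ a₁ a₂ y o)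
      (config (some .head) (.idle d x false ch L') []
        (matrixWord z (fun u v => initRel H (Ls u) (r u v) (b u v)) l.reverse m.reverse ++ w₁)
        w₂ a₁ a₂ y o)
      (l.length * (m.length + 1) + 1) := by
  induction l generalizing L w₁ with
  | nil =>
    refine ⟨L, ?_⟩
    rw [List.length_nil, zero_mul, zero_add]
    exact .single (step_eq_some rfl rfl fun k => by cases k <;> rfl)
  | cons u l ih =>
    obtain ⟨hu, hl⟩ := not_or.1 (mt List.mem_cons.2 hz)
    obtain ⟨L', h⟩ := ih (L := Ls u)
      (w₁ := matrixRow z (fun u v => initRel H (Ls u) (r u v) (b u v)) m.reverse u ++ w₁) hl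
    refine ⟨L', ?_⟩
    simp only [matrixWord, List.reverse_cons, List.flatMap_append, List.append_assoc,
      List.flatMap_cons, List.flatMap_nil, List.append_nil, List.cons_append, List.length_cons]
    exact ((runs_init_row Ls r b z u m (by simp [Ne.symm hu])).trans h).mono (by ring_nf; rfl)

end Matrix

end Steps

/-! ### The theorem -/

instance {V : Type} [Finite V] : Finite (State V) :=
  Finite.of_injective
    (fun s => (s.sym, s.rel, s.diag, s.first, s.mark, s.changed, s.list)) fun s t h => by
      simp only [Prod.mk.injEq] at h
      ext1 <;> simp only [h]

instance {V : Type} [Finite V] : Finite (InputSymbol V) :=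
  Finite.of_surjective
    (Sum.elim InputSymbol.vertex fun p : Bool × Bool => InputSymbol.pair p.1 p.2) fun a => by
      cases a with
      | vertex L => exact ⟨.inl L, rfl⟩
      | pair r b => exact ⟨.inr (r, b), rfl⟩

/-- The Turing machine for the list version of `CSP(H)`. -/
noncomputable def machine {V : Type} [Finite V] (H : Graph V) : FinTM2 where
  K := Stack
  k₀ := .inp
  k₁ := .out
  Γ := Alphabet V
  Λ := Label
  main := .init
  σ := State V
  initialState := .start
  σFin := Fintype.ofFinite _
  Γk₀Fin := Fintype.ofFinite (InputSymbol V)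
  m := program H

open scoped Classical in
theorem runs_machine {V : Type} [Finite V] {H : Graph V} {lvl : V → ℕ} (hl : H.IsLevel lvl)
    (I : ListInstance V) :
    Runs H (config (some .init) .start I.encode [] [] [] [] [] [])
      (config none .start [] [] [] [] [] [] [decide (I.IsYes H)])
      (2 * I.encode.length + 3 +
        (I.encode.length * Nat.card (V × V) + 1) * (4 * I.encode.length ^ 2)) := by
  obtain ⟨n, G, L⟩ := I
  cases n with
  | zero =>
    have hyes : ListInstance.IsYes ⟨0, G, L⟩ H :=
      ⟨fun u => u.elim0, ⟨fun u => u.elim0, fun u => u.elim0⟩, fun u => u.elim0⟩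
    rw [decide_eq_true hyes]
    have h1 : Runs H (config (some .head) (.idle ∅ ∅ true false ∅) [] [] [] [] [] [] [])
        (config none .start [] [] [] [] [] [] [true]) 1 :=
      .single (step_eq_some rfl rfl fun k => by cases k <;> rfl)
    exact (h1.cons (step_eq_some rfl rfl fun k => by cases k <;> rfl)).mono (by omega)
  | succ n =>
    set I : ListInstance V := ⟨n + 1, G, L⟩ with hI
    let l : List (Fin (n + 1)) := (List.finRange n).map Fin.succ
    have hfin : List.finRange (n + 1) = 0 :: l := List.finRange_succ
    have hnd : (0 :: l).Nodup := hfin ▸ List.nodup_finRange _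
    have hrev : (0 :: l).reverse = l.reverse ++ [0] := List.reverse_cons
    have hlen : I.encode.length = (n + 1) * (n + 1 + 1) := by
      simp [I, ListInstance.encode, List.length_flatMap]
    have hlen' : (0 :: l).length = n + 1 := by simp [l]
    let r : Fin (n + 1) → Fin (n + 1) → Bool := fun u v => decide (G.R u v)
    let b : Fin (n + 1) → Fin (n + 1) → Bool := fun u v => decide (G.B u v)
    have henc : I.encode = .vertex (L 0) :: ((0 :: l).map (fun v => .pair (r 0 v) (b 0 v)) ++
        l.flatMap fun u => .vertex (L u) :: (0 :: l).map fun v => .pair (r u v) (b u v)) := by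
      simp only [I, ListInstance.encode, hfin, List.flatMap_cons, List.cons_append]
      rfl
    let E₀ : Fin (n + 1) → Fin (n + 1) → SetRel V V := fun u v => initRel H (L u) (r u v) (b u v)
    have hword : matrixWord 0 E₀ l.reverse (0 :: l).reverse ++
        (matrixRow 0 E₀ (0 :: l).reverse 0 ++ []) =
        matrixWord 0 E₀ (l.reverse ++ [0]) (l.reverse ++ [0]) := by
      simp [matrixWord]
    obtain ⟨L', h1⟩ := runs_init_rows (H := H) (d := ∅) (x := ∅) (ch := false) (L := L 0)
      (w₁ := matrixRow 0 E₀ (0 :: l).reverse 0 ++ []) (w₂ := []) (a₁ := []) (a₂ := []) (y := [])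
      (o := []) L r b 0 l (0 :: l) (List.nodup_cons.1 hnd).1
    rw [hword] at h1
    have h2 := (runs_init_row (H := H) (d := ∅) (x := ∅) (mk := true) (ch := false) (L := ∅)
      (i := l.flatMap fun u => .vertex (L u) :: (0 :: l).map fun v => .pair (r u v) (b u v))
      (w₁ := []) (w₂ := []) (a₁ := []) (a₂ := []) (y := []) (o := []) L r b 0 0 (0 :: l)
      (by simp)).trans h1
    rw [← henc] at h2
    obtain ⟨E, hE, hle, hpres, d', x', h3⟩ := runs_loop (H := H) (d := ∅) (x := ∅) (mk := false)
      (L := L') (i := []) (o := []) (I.initMatrix H) 0 l.reverse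
      (by rw [← hrev]; exact List.nodup_reverse.2 hnd)
      (fun u => by rw [← hrev, List.mem_reverse, ← hfin]; exact List.mem_finRange u) (n := n + 1)
      (by rw [← hrev, List.length_reverse, hlen'])
    have hweight : weight (I.initMatrix H) ≤ (n + 1) * ((n + 1) * Nat.card (V × V)) := by
      simpa only [Nat.card_fin] using weight_le (I.initMatrix H)
    obtain ⟨u, l', hul⟩ : ∃ u l', l.reverse ++ [0] = u :: l' := by
      rw [← hrev]
      exact List.exists_cons_of_ne_nil (by simp)
    have hfirst : matrixWord 0 E (l.reverse ++ [0]) (l.reverse ++ [0]) =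
        .inl (E u u) :: (matrixWord 0 E (l.reverse ++ [0]) (l.reverse ++ [0])).tail := by
      rw [hul]
      rfl
    -- A solution survives in every entry; conversely, one nonempty diagonal entry makes all of them
    -- nonempty.
    have hans : decide (E u u).Nonempty = decide (I.IsYes H) := by
      refine decide_eq_decide.2 ⟨fun h => ?_, fun ⟨f, hf, hL⟩ => ?_⟩
      · exact I.isYes_of_pathConsistent hl hE hle fun w =>
          (hE.exists_mem_diag h w).imp' (fun a => (a, a)) fun _ => id
      · exact ⟨_, hpres f (I.preserves_initMatrix H hf hL) u u⟩
    have h4 := (h2.trans h3)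
    rw [hfirst] at h4
    have h5 := h4.trans (runs_answer _)
    rw [hans] at h5
    refine h5.mono ?_
    rw [List.length_tail, length_matrixWord, ← hrev, List.length_reverse, hlen', hlen]
    have hl' : l.length = n := by simp [l]
    rw [hl']
    set N := (n + 1) * (n + 1 + 1) with hN
    have hW : weight (I.initMatrix H) + 1 ≤ N * Nat.card (V × V) + 1 := by
      rw [hN, mul_assoc]
      exact Nat.succ_le_succ
        (hweight.trans (Nat.mul_le_mul_left _ (Nat.mul_le_mul_right _ (Nat.le_succ _))))
    -- A round consists of `n + 1` pivot steps of cost at most `4 * N` each.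
    have hround : (n + 1) * (4 * N) ≤ 4 * N ^ 2 := by
      have : n + 1 ≤ N := Nat.le_mul_of_pos_right _ (by omega)
      nlinarith
    have hmul := Nat.mul_le_mul hW hround
    -- Reading the input takes `N + 1` steps, and so does answering and clearing.
    have hinit : n + 1 + 1 + (n * (n + 1 + 1) + 1) = N + 1 := by rw [hN]; ring
    omega

theorem listCSPInPolyTime_of_isLevel {V : Type} [Finite V] {H : Graph V} {lvl : V → ℕ}
    (hl : H.IsLevel lvl) : H.ListCSPInPolyTime := by
  classical
  refine ⟨{
    tm := machine H
    inputAlphabet := Equiv.refl _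
    outputAlphabet := Equiv.refl _
    time := 2 * .X + 3 + (.X * .C (Nat.card (V × V)) + 1) * (4 * .X ^ 2)
    outputsFun := fun I => Classical.choice ?_ }⟩
  have h := runs_machine hl I
  refine h.elim fun h => ⟨⟨⟨h.steps, ?_⟩, ?_⟩⟩
  · have hinit : initList (machine H) (I.encode.map (Equiv.refl _).invFun) =
        config (some .init) .start I.encode [] [] [] [] [] [] := by
      refine congrArg (TM2.Cfg.mk _ _) (funext fun k => ?_)
      cases k
      · exact List.map_id _
      all_goals rfl
    have hhalt : haltList (machine H)
        ((Computability.encodeBool (decide (I.IsYes H))).map (Equiv.refl _).invFun) =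
        config none .start [] [] [] [] [] [] [decide (I.IsYes H)] := by
      refine congrArg (TM2.Cfg.mk _ _) (funext fun k => ?_)
      cases k <;> rfl
    exact ((congrArg (fun c => (flip bind (TM2.step (program H)))^[h.steps] (some c)) hinit).trans
      h.evals_in_steps).trans (congrArg some hhalt.symm)
  · refine h.steps_le_m.trans (le_of_eq ?_)
    simp

end TwoEC

theorem mainTheorem4 {V : Type} [Finite V] (H : TwoEC.Graph V)
    (hrefl : H.Reflexive) (hcomp : H.Complete) (hdec : H.HasDecomposition) :
    H.ListCSPInPolyTime := by
  obtain ⟨lvl, hl⟩ := hdec.exists_isLevel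
  exact TwoEC.listCSPInPolyTime_of_isLevel hl
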